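/- Let $\Gamma$ be a finite distance-regular graph with classical parameters $(D,b,\alpha,\beta)$, where $b,\alpha,\beta$ are real numbers, $b\ge 2$ and $D\ge 3$: that is, with $[j]=1+b+\cdots+b^{j-1}$, the graph $\Gamma$ is connected of diameter $D$, and for any two vertices $x,y$ at distance $i$ the number of neighbours of $y$ at distance $i+1$ from $x$ equals $b_i=([D]-[i])(\beta-\alpha[i])$ if $0\le i\le D-1$, and the number of neighbours of $y$ at distance $i-1$ from $x$ equals $c_i=[i](1+\alpha[i-1])$ if $1\le i\le D$. Let $k=b_0$ be the valency of $\Gamma$ and $\theta_{\min}$ the smallest eigenvalue of its adjacency matrix. Suppose that $\Gamma$ is geometric with respect to a set $\mathcal C$ of Delsarte cliques, i.e. every $C\in\mathcal C$ is a clique with exactly $1+\frac{k}{-\theta_{\min}}$ vertices, and every edge of $\Gamma$ lies in a unique $C\in\mathcal C$. Call the members of $\mathcal C$ lines. For a vertex $x$ and a line $\ell$ let $d(x,\ell)=\min\{d(x,y)\mid y\in\ell\}$, and for two vertices $x,y$ at distance $2$ let $[x,y]$ be the set of lines $m$ with $x\in m$ such that $d(y,u)\le 2$ for all $u\in m$.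 Let $r=[D]$. If $\beta>(r-\alpha-1)\alpha b+\alpha$, then for every vertex $x$ and every line $\ell$ with $d(x,\ell)=1$, and all vertices $y_1,y_2$ on $\ell$ with $d(x,y_1)=d(x,y_2)=2$, the sets of lines $[x,y_1]$ and $[x,y_2]$ are equal. -/

import Mathlib

open Finset

namespace ClassicalDRG

variable {V : Type*} [Fintype V] [DecidableEq V]

/-- The number `[j] = 1 + b + ⋯ + b ^ (j - 1)`; it equals `(b ^ j - 1) / (b - 1)` if `b ≠ 1`,
and `j` if `b = 1`. -/
def gaussNum (b : ℝ) (j : ℕ) : ℝ := ∑ i ∈ range j, b ^ i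

/-- `G` is connected, and for all vertices `x`, `y` at distance `i` there are exactly `c i`
neighbours of `y` at distance `i - 1` from `x` and exactly `b i` neighbours of `y` at distance
`i + 1` from `x`. (With `D` the diameter, `c 0 = 0` and `b D = 0` are then automatic, and the values
of `b` and `c` beyond `D` play no role.) -/
def IsDistanceRegularWith (G : SimpleGraph V) [DecidableRel G.Adj] (b c : ℕ → ℕ) : Prop :=
  G.Connected ∧ ∀ x y : V,
    #{z ∈ G.neighborFinset y | G.dist x z + 1 = G.dist x y} = c (G.dist x y) ∧
    #{z ∈ G.neighborFinset y | G.dist x z = G.dist x y + 1} = b (G.dist x y)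

/-- `G` is a distance-regular graph with classical parameters `(D, b, α, β)`. -/
def HasClassicalParameters (G : SimpleGraph V) [DecidableRel G.Adj]
    (D : ℕ) (b α β : ℝ) : Prop :=
  ∃ bs cs : ℕ → ℕ, IsDistanceRegularWith G bs cs ∧ G.diam = D ∧
    (∀ i, i < D →
      (bs i : ℝ) = (gaussNum b D - gaussNum b i) * (β - α * gaussNum b i)) ∧
    (∀ i, 1 ≤ i → i ≤ D →
      (cs i : ℝ) = gaussNum b i * (1 + α * gaussNum b (i - 1)))

/-- `θ` is the smallest eigenvalue of the adjacency matrix of `G`. -/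
def IsSmallestEigenvalue (G : SimpleGraph V) [DecidableRel G.Adj] (θ : ℝ) : Prop :=
  IsLeast {t : ℝ | Module.End.HasEigenvalue (Matrix.toLin' (G.adjMatrix ℝ)) t} θ

/-- A Delsarte clique: a clique with `1 + k / (-θ)` vertices, where `k` is the valency and `θ` the
smallest eigenvalue of the (regular) graph `G`. -/
def IsDelsarteClique (G : SimpleGraph V) [DecidableRel G.Adj] (C : Finset V) : Prop :=
  G.IsClique (C : Set V) ∧ ∃ (k : ℕ) (θ : ℝ),
    G.IsRegularOfDegree k ∧ IsSmallestEigenvalue G θ ∧ (#C : ℝ) = 1 + (k : ℝ) / (-θ)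

/-- `G` is geometric with respect to `𝒞`: the members of `𝒞` are Delsarte cliques, and each edge
lies in exactly one of them. The members of `𝒞` are called lines. -/
def IsGeometricWith (G : SimpleGraph V) [DecidableRel G.Adj] (𝒞 : Set (Finset V)) : Prop :=
  (∀ C ∈ 𝒞, IsDelsarteClique G C) ∧
    ∀ x y : V, G.Adj x y → ∃! C : Finset V, C ∈ 𝒞 ∧ x ∈ C ∧ y ∈ C

/-- The distance `d(x, ℓ) = min {d(x, y) | y ∈ ℓ}` from a vertex to a nonempty set of vertices. -/
noncomputable def distToSet (G : SimpleGraph V) (x : V) (l : Finset V) : ℕ :=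
  sInf {n : ℕ | ∃ y ∈ l, G.dist x y = n}

/-- `[x, y]`: the set of lines `m ∈ 𝒞` through `x` all of whose points are at distance at most `2`
from `y`. -/
def lineSet (G : SimpleGraph V) (𝒞 : Set (Finset V)) (x y : V) : Set (Finset V) :=
  {m | m ∈ 𝒞 ∧ x ∈ m ∧ ∀ u ∈ m, G.dist y u ≤ 2}

end ClassicalDRG

namespace ClassicalDRG

/-! The smallest eigenvalue is `-[D]`, so a line has `1 + β` points and every vertex is on `r = [D]`
lines. If `N` is the vertex-line incidence matrix, then `N Nᵀ = A + r I`, so an eigenvector for `-r`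
sums to zero on each line. For the eigenvector depending only on the distance to `x`, this forces a
line at distance `i < D` from `x` to have exactly `1 + α[i]` points at distance `i`. Hence `[x, y]`
consists of the lines through `x` that contain a neighbour of `y`, and it has `1 + b` members.

Now let `Y` be the set of `β - α` points of `ℓ` at distance 2 from `x`. If some `[x, y]` with `y ∈
Y` is contained in all the others, equal cardinality makes them all equal. Otherwise each `y ∈ Y`
has a line in `[x, y]` that is bad, i.e. missing from some `[x, y']`. A bad line is in at most `αb`
of the sets `[x, y]`, and at most `r - 1 - α` lines are bad, since those joining `x` to its `1 + α`
neighbours on `ℓ` are not. Thus `β - α ≤ (r - 1 - α)αb`, against the hypothesis. -/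

lemma exists_adj_dist_add_one_eq {V : Type*} {G : SimpleGraph V} (hG : G.Connected) {x y : V} {n : ℕ} (h : G.dist x y = n + 1) :
    ∃ z, G.Adj y z ∧ G.dist x z = n := by
  obtain ⟨p, hp⟩ := hG.exists_walk_length_eq_dist y x
  cases p with
  | nil => simp at h
  | @cons _ z _ hyz q =>
    refine ⟨z, hyz, ?_⟩
    rw [SimpleGraph.Walk.length_cons, G.dist_comm, h] at hp
    have h1 := SimpleGraph.dist_le q
    have h2 := hG.dist_triangle (u := x) (v := z) (w := y)
    rw [SimpleGraph.dist_eq_one_iff_adj.2 hyz.symm, h] at h2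
    rw [G.dist_comm] at h1
    omega

lemma dist_cases_of_adj {V : Type*} {G : SimpleGraph V} (hG : G.Connected) (x : V) {y z : V} (h : G.Adj y z) :
    G.dist x z + 1 = G.dist x y ∨ G.dist x z = G.dist x y ∨ G.dist x z = G.dist x y + 1 := by
  have h1 := hG.dist_triangle (u := x) (v := z) (w := y)
  have h2 := hG.dist_triangle (u := x) (v := y) (w := z)
  rw [SimpleGraph.dist_eq_one_iff_adj.2 h.symm] at h1
  rw [SimpleGraph.dist_eq_one_iff_adj.2 h] at h2
  omega

/-! ### Distance counts and the eigenvector for `-[D]` -/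

section Parameters

variable {V : Type*} [Fintype V] {G : SimpleGraph V} [DecidableRel G.Adj]
  {D : ℕ} {b α β : ℝ}

lemma gaussNum_zero (b : ℝ) : gaussNum b 0 = 0 := by simp [gaussNum]

lemma gaussNum_one (b : ℝ) : gaussNum b 1 = 1 := by simp [gaussNum]

lemma gaussNum_two (b : ℝ) : gaussNum b 2 = 1 + b := by simp [gaussNum, sum_range_succ]

lemma gaussNum_strictMono (hb : 0 < b) : StrictMono (gaussNum b) :=
  strictMono_nat_of_lt_succ fun n => by
    simp only [gaussNum, sum_range_succ]
    have := pow_pos hb n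
    linarith

namespace HasClassicalParameters

lemma connected (hG : HasClassicalParameters G D b α β) : G.Connected := by
  obtain ⟨bs, cs, h, -⟩ := hG
  exact h.1

lemma dist_le (hG : HasClassicalParameters G D b α β) (x y : V) : G.dist x y ≤ D := by
  have := hG.connected
  have := this.nonempty
  obtain ⟨bs, cs, h, hD, -⟩ := hG
  rw [← hD]
  exact SimpleGraph.dist_le_diam (SimpleGraph.connected_iff_ediam_ne_top.1 h.1)

lemma exists_dist_eq (hG : HasClassicalParameters G D b α β) {i : ℕ} (hi : i ≤ D) :
    ∃ x y, G.dist x y = i := by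
  have := hG.connected
  have := this.nonempty
  refine Nat.decreasingInduction (motive := fun i _ => ∃ x y, G.dist x y = i) ?_ ?_ hi
  · rintro n - ⟨x, y, hxy⟩
    obtain ⟨z, -, hz⟩ := exists_adj_dist_add_one_eq hG.connected hxy
    exact ⟨x, z, hz⟩
  · obtain ⟨bs, cs, h, hD, -⟩ := hG
    rw [← hD]
    exact SimpleGraph.exists_dist_eq_diam

/-- The number of neighbours of `y` that are closer to `x` than `y`. -/
lemma card_closer (hG : HasClassicalParameters G D b α β) (x y : V) :
    (#{z ∈ G.neighborFinset y | G.dist x z + 1 = G.dist x y} : ℝ) =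
      gaussNum b (G.dist x y) * (1 + α * gaussNum b (G.dist x y - 1)) := by
  have hle := hG.dist_le x y
  obtain ⟨bs, cs, h, hD, hb, hc⟩ := hG
  rcases Nat.eq_zero_or_pos (G.dist x y) with h0 | h0
  -- At distance 0 the truncated index `0 - 1` is harmless because `[0] = 0`.
  · simp [h0, gaussNum_zero]
  · rw [(h.2 x y).1, hc _ h0 hle]

/-- The number of neighbours of `y` that are further away from `x` than `y`. -/
lemma card_further (hG : HasClassicalParameters G D b α β) (x y : V) :
    (#{z ∈ G.neighborFinset y | G.dist x z = G.dist x y + 1} : ℝ) =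
      (gaussNum b D - gaussNum b (G.dist x y)) * (β - α * gaussNum b (G.dist x y)) := by
  have hle := hG.dist_le
  obtain ⟨bs, cs, h, hD, hb, hc⟩ := hG
  rcases (hle x y).eq_or_lt with h0 | h0
  · rw [h0, sub_self, zero_mul, Nat.cast_eq_zero, card_eq_zero, filter_eq_empty_iff]
    intro z _ hz
    have := hle x z
    omega
  · rw [(h.2 x y).2, hb _ h0]

lemma card_neighborFinset (hG : HasClassicalParameters G D b α β) (y : V) :
    (#(G.neighborFinset y) : ℝ) = gaussNum b D * β := by
  have h := hG.card_further y y
  rw [filter_true_of_mem] at h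
  · rw [h]; simp [gaussNum_zero]
  · intro z hz
    rw [SimpleGraph.mem_neighborFinset] at hz
    simp [SimpleGraph.dist_eq_one_iff_adj.2 hz]

/-- Some pair of vertices is at distance `i + 1`, so the count `b_i` is positive, while its factor
`[D] - [i]` is nonnegative. -/
lemma further_pos (hG : HasClassicalParameters G D b α β) (hb : 0 < b) {i : ℕ} (hi : i < D) :
    0 < β - α * gaussNum b i := by
  obtain ⟨x, y, hxy⟩ := hG.exists_dist_eq (Nat.succ_le_of_lt hi)
  obtain ⟨z, hz, hxz⟩ := exists_adj_dist_add_one_eq hG.connected hxy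
  have h := hG.card_further x z
  rw [hxz] at h
  have hpos : 0 < #{w ∈ G.neighborFinset z | G.dist x w = i + 1} :=
    card_pos.2 ⟨y, by simp [hz.symm, hxy]⟩
  rw [← Nat.cast_pos (α := ℝ), h] at hpos
  exact pos_of_mul_pos_right hpos (sub_nonneg.2 (gaussNum_strictMono hb hi).le)

lemma closer_pos (hG : HasClassicalParameters G D b α β) (hb : 0 < b) {i : ℕ} (hi : i < D) :
    0 < 1 + α * gaussNum b i := by
  obtain ⟨x, y, hxy⟩ := hG.exists_dist_eq (Nat.succ_le_of_lt hi)
  obtain ⟨z, hz, hxz⟩ := exists_adj_dist_add_one_eq hG.connected hxy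
  have h := hG.card_closer x y
  rw [hxy] at h
  have hpos : 0 < #{w ∈ G.neighborFinset y | G.dist x w + 1 = i.succ} :=
    card_pos.2 ⟨z, by simp [hz, hxz]⟩
  rw [← Nat.cast_pos (α := ℝ), h] at hpos
  exact pos_of_mul_pos_right hpos
    ((gaussNum_zero b).symm.le.trans ((gaussNum_strictMono hb).monotone (Nat.zero_le _)))

/-- The number of neighbours of `y` at the same distance from `x` as `y`. -/
lemma card_same (hG : HasClassicalParameters G D b α β) (x y : V) :
    (#{z ∈ G.neighborFinset y | G.dist x z = G.dist x y} : ℝ) = gaussNum b D * β -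
      gaussNum b (G.dist x y) * (1 + α * gaussNum b (G.dist x y - 1)) -
      (gaussNum b D - gaussNum b (G.dist x y)) * (β - α * gaussNum b (G.dist x y)) := by
  rw [← hG.card_closer, ← hG.card_further, ← hG.card_neighborFinset y]
  rw [← nsmul_one #(G.neighborFinset y), ← sum_const]
  simp only [card_filter, Nat.cast_sum, ← sum_sub_distrib]
  refine sum_congr rfl fun z hz => ?_
  rw [SimpleGraph.mem_neighborFinset] at hz
  rcases dist_cases_of_adj hG.connected x hz with h | h | h
  · simp [← h, add_assoc]
  · simp [h]
  · simp [h]; omega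

/-- The sum over the neighbours of `y` of a function of the distance to `x`. -/
lemma sum_neighborFinset_dist (hG : HasClassicalParameters G D b α β) (φ : ℕ → ℝ) (x y : V) :
    ∑ z ∈ G.neighborFinset y, φ (G.dist x z) =
      gaussNum b (G.dist x y) * (1 + α * gaussNum b (G.dist x y - 1)) * φ (G.dist x y - 1) +
      (gaussNum b D * β - gaussNum b (G.dist x y) * (1 + α * gaussNum b (G.dist x y - 1)) -
        (gaussNum b D - gaussNum b (G.dist x y)) * (β - α * gaussNum b (G.dist x y))) *
          φ (G.dist x y) +
      (gaussNum b D - gaussNum b (G.dist x y)) * (β - α * gaussNum b (G.dist x y)) *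
        φ (G.dist x y + 1) := by
  rw [← hG.card_same, ← hG.card_closer, ← hG.card_further]
  simp only [card_filter, Nat.cast_sum, sum_mul, ← sum_add_distrib]
  refine sum_congr rfl fun z hz => ?_
  rw [SimpleGraph.mem_neighborFinset] at hz
  rcases dist_cases_of_adj hG.connected x hz with h | h | h
  · simp [← h, add_assoc]
  · simp [h]
  · simp [h, add_assoc]

end HasClassicalParameters

/-- The standard sequence of the eigenvalue `-[D]`. -/
noncomputable def minSeq (b α β : ℝ) : ℕ → ℝ
  | 0 => 1
  | i + 1 => -(minSeq b α β i * (1 + α * gaussNum b i) / (β - α * gaussNum b i))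

namespace HasClassicalParameters

lemma minSeq_succ_mul (hG : HasClassicalParameters G D b α β) (hb : 0 < b) {i : ℕ} (hi : i < D) :
    minSeq b α β (i + 1) * (β - α * gaussNum b i) =
      -(minSeq b α β i * (1 + α * gaussNum b i)) := by
  have := (hG.further_pos hb hi).ne'
  rw [minSeq]
  field_simp

lemma abs_minSeq_pos (hG : HasClassicalParameters G D b α β) (hb : 0 < b) {i : ℕ} (hi : i ≤ D) :
    0 < |minSeq b α β i| := by
  induction i with
  | zero => simp [minSeq]
  | succ i ih =>
    have h1 := hG.further_pos hb hi
    have h2 := hG.closer_pos hb hi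
    have h3 := abs_pos.1 (ih (by omega))
    rw [abs_pos, minSeq]
    exact neg_ne_zero.2 (div_ne_zero (mul_ne_zero h3 h2.ne') h1.ne')

lemma abs_minSeq_succ_mul (hG : HasClassicalParameters G D b α β) (hb : 0 < b) {i : ℕ}
    (hi : i < D) : |minSeq b α β (i + 1)| * (β - α * gaussNum b i) =
      |minSeq b α β i| * (1 + α * gaussNum b i) := by
  have h := congrArg abs (hG.minSeq_succ_mul hb hi)
  rwa [abs_neg, abs_mul, abs_mul, abs_of_pos (hG.further_pos hb hi),
    abs_of_pos (hG.closer_pos hb hi)] at h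

lemma sum_neighborFinset_minSeq (hG : HasClassicalParameters G D b α β) (hb : 0 < b) (x y : V) :
    ∑ z ∈ G.neighborFinset y, minSeq b α β (G.dist x z) =
      -gaussNum b D * minSeq b α β (G.dist x y) := by
  rw [hG.sum_neighborFinset_dist (minSeq b α β)]
  have hle := hG.dist_le x y
  generalize G.dist x y = i at *
  have h1 : (gaussNum b D - gaussNum b i) * (β - α * gaussNum b i) * minSeq b α β (i + 1) =
      -((gaussNum b D - gaussNum b i) * (1 + α * gaussNum b i) * minSeq b α β i) := by
    -- For `i = D` the value `minSeq (D + 1)` is meaningless, but its coefficient vanishes.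
    rcases hle.eq_or_lt with h | h
    · simp [h]
    · linear_combination (gaussNum b D - gaussNum b i) * hG.minSeq_succ_mul hb h
  have h2 : gaussNum b i * (1 + α * gaussNum b (i - 1)) * minSeq b α β (i - 1) =
      -(gaussNum b i * (β - α * gaussNum b (i - 1)) * minSeq b α β i) := by
    rcases i with _ | i
    · simp [gaussNum_zero]
    · rw [Nat.add_sub_cancel]
      linear_combination gaussNum b (i + 1) * hG.minSeq_succ_mul hb hle
  rw [h1, h2]
  ring

/-- The eigenvector equation for `-[D]` with the off-diagonal signs reversed, as the standard
sequence alternates in sign. -/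
lemma abs_minSeq_recurrence (hG : HasClassicalParameters G D b α β) (hb : 0 < b) {i : ℕ}
    (hle : i ≤ D) :
    gaussNum b i * (1 + α * gaussNum b (i - 1)) * |minSeq b α β (i - 1)| +
      (gaussNum b D - gaussNum b i) * (β - α * gaussNum b i) * |minSeq b α β (i + 1)| =
    (gaussNum b D * β - gaussNum b i * (1 + α * gaussNum b (i - 1)) -
      (gaussNum b D - gaussNum b i) * (β - α * gaussNum b i) + gaussNum b D) *
        |minSeq b α β i| := by
  have h1 : (gaussNum b D - gaussNum b i) * (β - α * gaussNum b i) * |minSeq b α β (i + 1)| =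
      (gaussNum b D - gaussNum b i) * (1 + α * gaussNum b i) * |minSeq b α β i| := by
    rcases hle.eq_or_lt with h | h
    · simp [h]
    · linear_combination (gaussNum b D - gaussNum b i) * hG.abs_minSeq_succ_mul hb h
  have h2 : gaussNum b i * (1 + α * gaussNum b (i - 1)) * |minSeq b α β (i - 1)| =
      gaussNum b i * (β - α * gaussNum b (i - 1)) * |minSeq b α β i| := by
    rcases i with _ | i
    · simp [gaussNum_zero]
    · rw [Nat.add_sub_cancel]
      linear_combination -gaussNum b (i + 1) * hG.abs_minSeq_succ_mul hb hle
  rw [h1, h2]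
  ring

/-! ### The smallest eigenvalue and the size of Delsarte cliques -/

variable [DecidableEq V]

/-- Pair an eigenvector `f` with the radial function of profile `φ i = sign (g i) * |u_i|`, where
`u` is the standard sequence and `g i` the sum of `f` over the sphere of radius `i` about `x`. By
self-adjointness `θ⟨φ, f⟩ = ⟨Aφ, f⟩`. The off-diagonal terms are bounded below using `|φ j| ≤
|u_j|`, and the recurrence for `|u|` turns the bound into `-[D]⟨φ, f⟩`. -/
lemma neg_gaussNum_le_of_hasEigenvalue (hG : HasClassicalParameters G D b α β) (hb : 0 < b) {θ : ℝ}
    (hθ : Module.End.HasEigenvalue (Matrix.toLin' (G.adjMatrix ℝ)) θ) : -gaussNum b D ≤ θ := by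
  obtain ⟨f, hf⟩ := hθ.exists_hasEigenvector
  have hAf : ∀ y, ∑ z ∈ G.neighborFinset y, f z = θ * f y := fun y => by
    have := congrFun hf.apply_eq_smul y
    rwa [Matrix.toLin'_apply, SimpleGraph.adjMatrix_mulVec_apply, Pi.smul_apply,
      smul_eq_mul] at this
  obtain ⟨x, hx⟩ := Function.ne_iff.1 hf.2
  set g : ℕ → ℝ := fun i => ∑ y with G.dist x y = i, f y with hg
  have hsum : ∀ φ : ℕ → ℝ, ∑ y, φ (G.dist x y) * f y = ∑ i ∈ range (D + 1), φ i * g i := by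
    intro φ
    rw [← sum_fiberwise_of_maps_to (g := fun y => G.dist x y) (t := range (D + 1))
      (fun y _ => by simpa [Nat.lt_succ_iff] using hG.dist_le x y)]
    refine sum_congr rfl fun i _ => ?_
    rw [hg, mul_sum]
    refine sum_congr rfl fun y hy => ?_
    rw [(mem_filter.1 hy).2]
  set φ : ℕ → ℝ := fun i => SignType.sign (g i) * |minSeq b α β i| with hφ
  have hpair : θ * ∑ y, φ (G.dist x y) * f y =
      ∑ y, (∑ z ∈ G.neighborFinset y, φ (G.dist x z)) * f y := by
    calc _ = ∑ y, ∑ z, if G.Adj y z then φ (G.dist x y) * f z else 0 := by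
            rw [mul_sum]
            refine sum_congr rfl fun y _ => ?_
            rw [mul_left_comm, ← hAf, mul_sum, ← sum_filter, SimpleGraph.neighborFinset_eq_filter]
      _ = _ := by
            rw [sum_comm]
            refine sum_congr rfl fun y _ => ?_
            rw [sum_mul, SimpleGraph.neighborFinset_eq_filter, sum_filter]
            refine sum_congr rfl fun z _ => ?_
            simp only [G.adj_comm]
  have hφg : ∀ i, φ i * g i = |g i| * |minSeq b α β i| := fun i => by
    rw [hφ]
    dsimp only
    rw [mul_right_comm, sign_mul_self]
  have hφabs : ∀ i, |φ i| ≤ |minSeq b α β i| := fun i => by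
    rw [hφ]
    dsimp only
    rw [abs_mul, abs_abs]
    refine mul_le_of_le_one_left (abs_nonneg _) ?_
    rcases lt_trichotomy (g i) 0 with h | h | h <;> simp [h]
  simp only [hG.sum_neighborFinset_dist φ] at hpair
  rw [hsum φ, hsum fun i => gaussNum b i * (1 + α * gaussNum b (i - 1)) * φ (i - 1) +
      (gaussNum b D * β - gaussNum b i * (1 + α * gaussNum b (i - 1)) -
        (gaussNum b D - gaussNum b i) * (β - α * gaussNum b i)) * φ i +
      (gaussNum b D - gaussNum b i) * (β - α * gaussNum b i) * φ (i + 1)] at hpair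
  have hS : 0 < ∑ i ∈ range (D + 1), φ i * g i := by
    simp only [hφg]
    refine sum_pos' (fun i _ => by positivity) ⟨0, by simp, ?_⟩
    -- The base point was chosen with `f x ≠ 0`, which makes the pairing strictly positive.
    have h0 : g 0 = f x := by
      have : (univ.filter fun y => G.dist x y = 0) = {x} := by
        ext y
        simp [hG.connected.dist_eq_zero_iff, eq_comm]
      rw [hg]
      dsimp only
      rw [this, sum_singleton]
    rw [h0]
    exact mul_pos (abs_pos.2 hx) (hG.abs_minSeq_pos hb (Nat.zero_le D))
  have hle : -gaussNum b D * ∑ i ∈ range (D + 1), φ i * g i ≤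
      θ * ∑ i ∈ range (D + 1), φ i * g i := by
    rw [hpair, mul_sum]
    refine sum_le_sum fun i hi => ?_
    have hi : i ≤ D := Nat.lt_succ_iff.1 (mem_range.1 hi)
    have hrec := hG.abs_minSeq_recurrence hb hi
    obtain ⟨x', y', hxy⟩ := hG.exists_dist_eq hi
    have hc := hG.card_closer x' y'
    have hd := hG.card_further x' y'
    rw [hxy] at hc hd
    have hc0 := (Nat.cast_nonneg _).trans hc.le
    have hd0 := (Nat.cast_nonneg _).trans hd.le
    generalize gaussNum b i * (1 + α * gaussNum b (i - 1)) = c at *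
    generalize (gaussNum b D - gaussNum b i) * (β - α * gaussNum b i) = d at *
    have key : ∀ j, -(|minSeq b α β j| * |g i|) ≤ φ j * g i := fun j =>
      (neg_le_neg (mul_le_mul_of_nonneg_right (hφabs j) (abs_nonneg (g i)))).trans
        ((abs_mul (φ j) (g i)) ▸ neg_abs_le (φ j * g i))
    have h1 := mul_le_mul_of_nonneg_left (key (i - 1)) hc0
    have h2 := mul_le_mul_of_nonneg_left (key (i + 1)) hd0
    have h3 := congrArg (· * |g i|) hrec
    have h4 := hφg i
    linear_combination h1 + h2 + h3 - (gaussNum b D * β - c - d + gaussNum b D) * h4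
  exact le_of_mul_le_mul_right hle hS

lemma hasEigenvalue_neg_gaussNum (hG : HasClassicalParameters G D b α β) (hb : 0 < b) :
    Module.End.HasEigenvalue (Matrix.toLin' (G.adjMatrix ℝ)) (-gaussNum b D) := by
  obtain ⟨x⟩ := hG.connected.nonempty
  refine Module.End.hasEigenvalue_of_hasEigenvector
    (x := fun y => minSeq b α β (G.dist x y)) ⟨Module.End.mem_eigenspace_iff.2 ?_, ?_⟩
  · ext y
    rw [Matrix.toLin'_apply, SimpleGraph.adjMatrix_mulVec_apply,
      hG.sum_neighborFinset_minSeq hb, Pi.smul_apply, smul_eq_mul]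
  · intro h
    simpa [minSeq] using congrFun h x

lemma eq_neg_gaussNum (hG : HasClassicalParameters G D b α β) (hb : 0 < b) {θ : ℝ}
    (hθ : IsSmallestEigenvalue G θ) : θ = -gaussNum b D :=
  (hθ.2 (hG.hasEigenvalue_neg_gaussNum hb)).antisymm (hG.neg_gaussNum_le_of_hasEigenvalue hb hθ.1)

lemma card_of_isDelsarteClique (hG : HasClassicalParameters G D b α β) (hb : 0 < b) (hD : 0 < D)
    {C : Finset V} (hC : IsDelsarteClique G C) : (#C : ℝ) = 1 + β := by
  obtain ⟨-, k, θ, hk, hθ, h⟩ := hC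
  obtain ⟨x⟩ := hG.connected.nonempty
  have hx := hG.card_neighborFinset x
  rw [SimpleGraph.card_neighborFinset_eq_degree, hk x] at hx
  have hr := gaussNum_zero b ▸ gaussNum_strictMono hb hD
  rw [h, hG.eq_neg_gaussNum hb hθ, hx, neg_neg, mul_div_cancel_left₀ _ hr.ne']

end HasClassicalParameters

end Parameters

/-! ### Counting points on lines by distance -/

section Lines

variable {V : Type*} [Fintype V] [DecidableEq V] {G : SimpleGraph V} [DecidableRel G.Adj]
  {𝒞 : Set (Finset V)}

open Classical in
/-- The finite set of lines through a vertex. -/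
noncomputable def linesThrough (𝒞 : Set (Finset V)) (x : V) : Finset (Finset V) :=
  univ.filter fun C => C ∈ 𝒞 ∧ x ∈ C

lemma mem_linesThrough {x : V} {C : Finset V} : C ∈ linesThrough 𝒞 x ↔ C ∈ 𝒞 ∧ x ∈ C := by
  simp [linesThrough]

namespace IsGeometricWith

lemma eq_of_mem (h : IsGeometricWith G 𝒞) {C C' : Finset V} (hC : C ∈ 𝒞) (hC' : C' ∈ 𝒞) {x y : V}
    (hxy : x ≠ y) (hx : x ∈ C) (hy : y ∈ C) (hx' : x ∈ C') (hy' : y ∈ C') : C = C' :=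
  (h.2 x y ((h.1 C hC).1 hx hy hxy)).unique ⟨hC, hx, hy⟩ ⟨hC', hx', hy'⟩

lemma sum_neighborFinset (h : IsGeometricWith G 𝒞) {M : Type*} [AddCommMonoid M] (f : V → M)
    (x : V) :
    ∑ z ∈ G.neighborFinset x, f z = ∑ C ∈ linesThrough 𝒞 x, ∑ z ∈ C.erase x, f z := by
  rw [← sum_biUnion]
  · refine sum_congr ?_ fun _ _ => rfl
    ext z
    simp only [SimpleGraph.mem_neighborFinset, mem_biUnion, mem_linesThrough, mem_erase]
    constructor
    · intro hz
      obtain ⟨C, ⟨hC, hx, hzC⟩, -⟩ := h.2 x z hz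
      exact ⟨C, ⟨hC, hx⟩, hz.ne', hzC⟩
    · rintro ⟨C, ⟨hC, hx⟩, hne, hz⟩
      exact (h.1 C hC).1 hx hz hne.symm
  · intro C hC C' hC' hne
    rw [mem_coe, mem_linesThrough] at hC hC'
    rw [Function.onFun, disjoint_left]
    intro z hz hz'
    rw [mem_erase] at hz hz'
    exact hne (h.eq_of_mem hC.1 hC'.1 hz.1 hz.2 hC.2 hz'.2 hC'.2)

variable {D : ℕ} {b α β : ℝ}

lemma card_linesThrough (h : IsGeometricWith G 𝒞) (hG : HasClassicalParameters G D b α β)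
    (hb : 0 < b) (hD : 0 < D) (x : V) : (#(linesThrough 𝒞 x) : ℝ) = gaussNum b D := by
  have hβ : 0 < β := by simpa [gaussNum_zero] using hG.further_pos hb hD
  have hk := hG.card_neighborFinset x
  have hs := h.sum_neighborFinset (fun _ => (1 : ℝ)) x
  have hC : ∀ C ∈ linesThrough 𝒞 x, ∑ z ∈ C.erase x, (1 : ℝ) = β := fun C hC => by
    rw [mem_linesThrough] at hC
    have h1 := hG.card_of_isDelsarteClique hb hD (h.1 C hC.1)
    rw [sum_const, nsmul_one, cast_card_erase_of_mem hC.2, h1, add_sub_cancel_left]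
  rw [sum_congr rfl hC, sum_const, sum_const, nsmul_one, nsmul_eq_mul, hk] at hs
  exact (mul_right_cancel₀ hβ.ne' hs).symm

/-- An eigenvector for the smallest eigenvalue sums to zero on every line. -/
lemma sum_minSeq (h : IsGeometricWith G 𝒞) (hG : HasClassicalParameters G D b α β)
    (hb : 0 < b) (hD : 0 < D) (x : V) {C : Finset V} (hC : C ∈ 𝒞) :
    ∑ z ∈ C, minSeq b α β (G.dist x z) = 0 := by
  classical
  set v : V → ℝ := fun z => minSeq b α β (G.dist x z)
  have hv : ∀ z, ∑ w ∈ G.neighborFinset z, v w = -gaussNum b D * v z :=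
    hG.sum_neighborFinset_minSeq hb x
  -- The sum of squares of the line sums is `vᵀ(A + rI)v`, which vanishes.
  have h0 : ∑ C with C ∈ 𝒞, (∑ z ∈ C, v z) ^ 2 = 0 := by
    calc ∑ C with C ∈ 𝒞, (∑ z ∈ C, v z) ^ 2
        = ∑ C with C ∈ 𝒞, ∑ z ∈ C, v z * ∑ w ∈ C, v w :=
          sum_congr rfl fun C _ => by rw [sq, sum_mul]
      _ = ∑ z, ∑ C ∈ linesThrough 𝒞 z, v z * ∑ w ∈ C, v w :=
          sum_comm' fun C z => by simp [mem_linesThrough]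
      _ = ∑ z : V, 0 := sum_congr rfl fun z _ => by
          have hC : ∀ C ∈ linesThrough 𝒞 z, ∑ w ∈ C, v w = v z + ∑ w ∈ C.erase z, v w :=
            fun C hC => (add_sum_erase _ _ (mem_linesThrough.1 hC).2).symm
          rw [← mul_sum, sum_congr rfl hC, sum_add_distrib, ← h.sum_neighborFinset, hv, sum_const,
            nsmul_eq_mul, h.card_linesThrough hG hb hD]
          ring
      _ = 0 := sum_const_zero
  have := (sum_eq_zero_iff_of_nonneg fun C _ => sq_nonneg _).1 h0 C (by simpa using hC)
  exact pow_eq_zero_iff two_ne_zero |>.1 this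

/-- A line at distance `i` from `x` has `1 + α [i]` points at distance `i` from `x`. -/
lemma card_filter_dist (h : IsGeometricWith G 𝒞) (hG : HasClassicalParameters G D b α β)
    (hb : 0 < b) {i : ℕ} (hi : i < D) {x y : V} {C : Finset V} (hC : C ∈ 𝒞) (hy : y ∈ C)
    (hxy : G.dist x y = i) (hle : ∀ z ∈ C, i ≤ G.dist x z) :
    (#{z ∈ C | G.dist x z = i} : ℝ) = 1 + α * gaussNum b i := by
  have hD : 0 < D := by omega
  have hs := h.sum_minSeq hG hb hD x hC
  have hcard := hG.card_of_isDelsarteClique hb hD (h.1 C hC)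
  have hfar : ∀ z ∈ C, G.dist x z ≠ i → G.dist x z = i + 1 := by
    intro z hz hne
    have hyz : y ≠ z := by rintro rfl; exact hne hxy
    have h1 := dist_cases_of_adj hG.connected x ((h.1 C hC).1 hy hz hyz)
    have h2 := hle z hz
    omega
  rw [← sum_filter_add_sum_filter_not C (fun z => G.dist x z = i),
    sum_congr rfl fun z hz => by rw [(mem_filter.1 hz).2], sum_const,
    sum_congr (s₁ := {z ∈ C | ¬G.dist x z = i}) rfl fun z hz => by
      rw [hfar z (mem_filter.1 hz).1 (mem_filter.1 hz).2], sum_const, nsmul_eq_mul,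
    nsmul_eq_mul] at hs
  rw [← card_filter_add_card_filter_not (fun z => G.dist x z = i), Nat.cast_add] at hcard
  generalize (#{z ∈ C | G.dist x z = i} : ℝ) = p at *
  generalize (#{z ∈ C | ¬G.dist x z = i} : ℝ) = q at *
  have hrec := hG.minSeq_succ_mul hb hi
  have hu := abs_pos.1 (hG.abs_minSeq_pos hb hi.le)
  have h1 := hG.further_pos hb hi
  have h2 := hG.closer_pos hb hi
  generalize gaussNum b i = g at *
  generalize minSeq b α β i = u at *
  generalize minSeq b α β (i + 1) = u' at *
  -- With `p` points at distance `i` and `q` at distance `i + 1`, the zero sum `p u + q u' = 0` and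
  -- the recursion give `p(β - αg) = q(1 + αg)`; then `p + q = 1 + β` determines `p`.
  have h3 : u * (p * (β - α * g) - q * (1 + α * g)) = 0 := by
    linear_combination (β - α * g) * hs - q * hrec
  have h4 := (mul_eq_zero.1 h3).resolve_left hu
  have h5 : (p - (1 + α * g)) * (1 + β) = 0 := by
    linear_combination h4 + (1 + α * g) * hcard
  have h6 : 0 < 1 + β := by linarith
  exact sub_eq_zero.1 ((mul_eq_zero.1 h5).resolve_right h6.ne')

/-- At distance `2`, a line `m` through `x` belongs to `[x, y]` if and only if `y` has a neighbour
on `m`. -/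
lemma mem_lineSet_iff (h : IsGeometricWith G 𝒞) (hG : HasClassicalParameters G D b α β)
    (hb : 0 < b) (hD : 3 ≤ D) {x y : V} (hxy : G.dist x y = 2) {m : Finset V} :
    m ∈ lineSet G 𝒞 x y ↔ m ∈ linesThrough 𝒞 x ∧ ∃ z ∈ m, G.dist y z = 1 := by
  rw [G.dist_comm] at hxy
  rw [mem_linesThrough]
  constructor
  · rintro ⟨hm, hx, hle⟩
    refine ⟨⟨hm, hx⟩, ?_⟩
    by_contra! hne
    have hmin : ∀ z ∈ m, 2 ≤ G.dist y z := by
      intro z hz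
      by_contra! hlt
      have h0 : G.dist y z = 0 := by have := hne z hz; omega
      rw [hG.connected.dist_eq_zero_iff] at h0
      subst h0
      have h1 : y ≠ x := by rintro rfl; simp at hxy
      rw [SimpleGraph.dist_eq_one_iff_adj.2 ((h.1 m hm).1 hz hx h1)] at hxy
      omega
    -- Without a neighbour of `y`, all `1 + β` points of `m` would be at distance 2 from `y`, but
    -- only `1 + α[2] < 1 + β` can be.
    have hcard := h.card_filter_dist hG hb (i := 2) (by omega) hm hx hxy hmin
    rw [filter_true_of_mem fun z hz => le_antisymm (hle z hz) (hmin z hz),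
      hG.card_of_isDelsarteClique hb (by omega) (h.1 m hm)] at hcard
    have := hG.further_pos hb (i := 2) (by omega)
    linarith
  · rintro ⟨⟨hm, hx⟩, z, hz, hyz⟩
    refine ⟨hm, hx, fun u hu => ?_⟩
    by_cases hzu : z = u
    · subst hzu; omega
    · have := dist_cases_of_adj hG.connected y ((h.1 m hm).1 hz hu hzu)
      omega

open Classical in
/-- There are `1 + b` lines in `[x, y]`. -/
lemma card_lineSet (h : IsGeometricWith G 𝒞) (hG : HasClassicalParameters G D b α β)
    (hb : 0 < b) (hD : 3 ≤ D) {x y : V} (hxy : G.dist x y = 2) :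
    (#{m ∈ linesThrough 𝒞 x | m ∈ lineSet G 𝒞 x y} : ℝ) = 1 + b := by
  have hyx : G.dist y x = 2 := by rwa [G.dist_comm]
  have hc := hG.card_closer y x
  have hcl := hG.closer_pos hb (i := 1) (by omega)
  rw [hyx, gaussNum_two, card_filter, Nat.cast_sum, h.sum_neighborFinset] at hc
  have hline : ∀ m ∈ linesThrough 𝒞 x,
      ∑ z ∈ m.erase x, ((if G.dist y z + 1 = 2 then 1 else 0 : ℕ) : ℝ) =
        if m ∈ lineSet G 𝒞 x y then 1 + α * gaussNum b 1 else 0 := by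
    intro m hm
    have hm' := mem_linesThrough.1 hm
    rw [← Nat.cast_sum, ← card_filter]
    have hfilter : {z ∈ m.erase x | G.dist y z + 1 = 2} = {z ∈ m | G.dist y z = 1} := by
      ext z
      simp only [mem_filter, mem_erase]
      constructor
      · rintro ⟨⟨-, hz⟩, h1⟩
        exact ⟨hz, by omega⟩
      · rintro ⟨hz, h1⟩
        refine ⟨⟨?_, hz⟩, by omega⟩
        rintro rfl
        omega
    rw [hfilter]
    split_ifs with hmem
    · obtain ⟨-, z, hz, hyz⟩ := (h.mem_lineSet_iff hG hb hD hxy).1 hmem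
      refine h.card_filter_dist hG hb (by omega) hm'.1 hz hyz fun w hw => ?_
      by_contra! hlt
      rw [Nat.lt_one_iff, hG.connected.dist_eq_zero_iff] at hlt
      subst hlt
      have h1 : y ≠ x := by rintro rfl; simp at hxy
      rw [SimpleGraph.dist_eq_one_iff_adj.2 ((h.1 m hm'.1).1 hw hm'.2 h1)] at hyx
      omega
    · rw [Nat.cast_eq_zero, card_eq_zero, filter_eq_empty_iff]
      exact fun z hz hyz => hmem ((h.mem_lineSet_iff hG hb hD hxy).2 ⟨hm, z, hz, hyz⟩)
  rw [sum_congr rfl hline, ← sum_filter, sum_const, nsmul_eq_mul] at hc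
  exact mul_right_cancel₀ hcl.ne' hc

end IsGeometricWith

end Lines

/-! ### The sets `[x, y]` along a line at distance 1 -/

section Main

variable {V : Type*} [Fintype V] [DecidableEq V] {G : SimpleGraph V} [DecidableRel G.Adj]
  {𝒞 : Set (Finset V)} {D : ℕ} {b α β : ℝ} {x : V} {l : Finset V}

namespace IsGeometricWith

/-- The neighbours of `x` on a line at distance `1` lie on distinct lines through `x`. -/
lemma card_filter_dist_one_le (h : IsGeometricWith G 𝒞) (hl : l ∈ 𝒞) (hxl : x ∉ l)
    {F : Finset (Finset V)}
    (hF : ∀ m ∈ linesThrough 𝒞 x, (∃ z ∈ l, z ∈ m ∧ G.dist x z = 1) → m ∈ F) :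
    #{z ∈ l | G.dist x z = 1} ≤ #F := by
  have hex : ∀ z ∈ ({z ∈ l | G.dist x z = 1} : Finset V), ∃ m ∈ linesThrough 𝒞 x, z ∈ m := by
    intro z hz
    obtain ⟨m, ⟨hm, hx, hzm⟩, -⟩ := h.2 x z (SimpleGraph.dist_eq_one_iff_adj.1 (mem_filter.1 hz).2)
    exact ⟨m, mem_linesThrough.2 ⟨hm, hx⟩, hzm⟩
  choose! f hf hzf using hex
  refine card_le_card_of_injOn f (fun z hz => ?_) fun z hz z' hz' heq => ?_
  · have hz' := mem_filter.1 hz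
    exact hF _ (hf z hz) ⟨z, hz'.1, hzf z hz, hz'.2⟩
  · by_contra hne
    have hm := mem_linesThrough.1 (hf z hz)
    have := h.eq_of_mem hm.1 hl hne (hzf z hz) (heq ▸ hzf z' hz') (mem_filter.1 hz).1
      (mem_filter.1 hz').1
    exact hxl (this ▸ hm.2)

open Classical in
/-- If a line `m` through `x` is not in `[x, y]` for some point `y` at distance `2` from `x` of the
line `l` at distance `1` from `x`, then it is in `[x, y']` for few such points `y'`. -/
lemma card_filter_mem_lineSet_le (h : IsGeometricWith G 𝒞) (hG : HasClassicalParameters G D b α β)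
    (hb : 0 < b) (hD : 3 ≤ D) (hl : l ∈ 𝒞) {z₀ : V} (hz₀ : z₀ ∈ l) (hxz₀ : G.dist x z₀ = 1)
    (hmin : ∀ z ∈ l, 1 ≤ G.dist x z) {y : V} (hy : y ∈ l) (hxy : G.dist x y = 2) {m : Finset V}
    (hm : m ∈ linesThrough 𝒞 x) (hmy : m ∉ lineSet G 𝒞 x y) :
    (#{y' ∈ l | G.dist x y' = 2 ∧ m ∈ lineSet G 𝒞 x y'} : ℝ) ≤ α * b := by
  rw [mem_linesThrough] at hm
  obtain ⟨w, hw, hyw⟩ : ∃ w ∈ m, 2 < G.dist y w := by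
    by_contra! hle
    exact hmy ⟨hm.1, hm.2, hle⟩
  have hxw : G.Adj x w := by
    refine (h.1 m hm.1).1 hm.2 hw ?_
    rintro rfl
    rw [G.dist_comm] at hxy
    omega
  have hwy : 2 < G.dist w y := by rwa [G.dist_comm]
  -- A point of the clique `l` is at distance at least 3 from `w`, so no point of `l` is closer than
  -- 2.
  have hw2 : ∀ z ∈ l, 2 ≤ G.dist w z := by
    intro z hz
    by_cases hzy : y = z
    · subst hzy; omega
    · have := dist_cases_of_adj hG.connected w ((h.1 l hl).1 hy hz hzy)
      omega
  have hwN : ∀ z ∈ l, G.dist x z = 1 → G.dist w z = 2 := by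
    intro z hz hxz
    have h1 := hG.connected.dist_triangle (u := w) (v := x) (w := z)
    rw [SimpleGraph.dist_eq_one_iff_adj.2 hxw.symm] at h1
    have := hw2 z hz
    omega
  have h1 := h.card_filter_dist hG hb (by omega) hl hz₀ hxz₀ hmin
  have h2 := h.card_filter_dist hG hb (by omega) hl hz₀ (hwN z₀ hz₀ hxz₀) hw2
  have hdisj : Disjoint ({z ∈ l | G.dist x z = 1} : Finset V)
      {y' ∈ l | G.dist x y' = 2 ∧ m ∈ lineSet G 𝒞 x y'} := by
    rw [disjoint_left]
    intro z hz hz'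
    have h3 := (mem_filter.1 hz).2
    have h4 := (mem_filter.1 hz').2.1
    omega
  have hsub : ({z ∈ l | G.dist x z = 1} : Finset V) ∪
      {y' ∈ l | G.dist x y' = 2 ∧ m ∈ lineSet G 𝒞 x y'} ⊆ {z ∈ l | G.dist w z = 2} := by
    intro z hz
    rw [mem_union, mem_filter, mem_filter] at hz
    rw [mem_filter]
    rcases hz with ⟨hz, hxz⟩ | ⟨hz, hxz, hmem⟩
    · exact ⟨hz, hwN z hz hxz⟩
    · refine ⟨hz, le_antisymm ?_ (hw2 z hz)⟩
      rw [G.dist_comm]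
      exact hmem.2.2 w hw
  have hle := card_le_card hsub
  rw [card_union_of_disjoint hdisj, ← Nat.cast_le (α := ℝ), Nat.cast_add, h1, h2, gaussNum_one,
    gaussNum_two] at hle
  linarith

/-- For two points `y₁`, `y₂` at distance `2` from `x` of a line at distance `1` from `x`, the sets
`[x, y₁]` and `[x, y₂]` coincide if `β` is large. -/
lemma lineSet_eq_lineSet (h𝒞 : IsGeometricWith G 𝒞) (hG : HasClassicalParameters G D b α β)
    (hb : 0 < b) (hD : 3 ≤ D) (hβ : (gaussNum b D - α - 1) * α * b + α < β)
    (hl : l ∈ 𝒞) (hxl : distToSet G x l = 1) {y₁ y₂ : V} (hy₁ : y₁ ∈ l) (hy₂ : y₂ ∈ l)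
    (hxy₁ : G.dist x y₁ = 2) (hxy₂ : G.dist x y₂ = 2) :
    lineSet G 𝒞 x y₁ = lineSet G 𝒞 x y₂ := by
  classical
  have hmin : ∀ z ∈ l, 1 ≤ G.dist x z := fun z hz => hxl ▸ Nat.sInf_le ⟨z, hz, rfl⟩
  obtain ⟨z₀, hz₀, hxz₀⟩ : ∃ z ∈ l, G.dist x z = 1 :=
    hxl ▸ Nat.sInf_mem (s := {n | ∃ y ∈ l, G.dist x y = n}) ⟨_, y₁, hy₁, rfl⟩
  have hx : x ∉ l := fun hx => by simpa using hmin x hx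
  have hN := h𝒞.card_filter_dist hG hb (by omega) hl hz₀ hxz₀ hmin
  rw [gaussNum_one, mul_one] at hN
  have hα : 0 ≤ α := by
    have hpos : 1 ≤ #{z ∈ l | G.dist x z = 1} := card_pos.2 ⟨z₀, mem_filter.2 ⟨hz₀, hxz₀⟩⟩
    rw [← Nat.cast_le (α := ℝ), hN, Nat.cast_one] at hpos
    linarith
  have hfar : ∀ z ∈ l, ¬G.dist x z = 1 ↔ G.dist x z = 2 := by
    intro z hz
    by_cases hzz : z₀ = z
    · subst hzz; omega
    · have h1 := dist_cases_of_adj hG.connected x ((h𝒞.1 l hl).1 hz₀ hz hzz)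
      have h2 := hmin z hz
      omega
  set S : V → Finset (Finset V) := fun y => {m ∈ linesThrough 𝒞 x | m ∈ lineSet G 𝒞 x y}
  have hS : ∀ y, (S y : Set (Finset V)) = lineSet G 𝒞 x y := by
    intro y
    ext m
    simp only [S, coe_filter, mem_linesThrough, Set.mem_ofPred_eq, and_iff_right_iff_imp]
    exact fun hm => ⟨hm.1, hm.2.1⟩
  set Y : Finset V := {y ∈ l | G.dist x y = 2}
  have hY : (#Y : ℝ) = β - α := by
    have h1 := hG.card_of_isDelsarteClique hb (by omega) (h𝒞.1 l hl)
    rw [← card_filter_add_card_filter_not (fun z => G.dist x z = 1), Nat.cast_add, hN,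
      filter_congr hfar] at h1
    linarith
  rw [← hS, ← hS, coe_inj]
  by_cases hgood : ∃ y ∈ Y, ∀ m ∈ S y, ∀ y' ∈ Y, m ∈ S y'
  · obtain ⟨y, hy, hsub⟩ := hgood
    have heq : ∀ y' ∈ Y, S y = S y' := by
      intro y' hy'
      refine eq_of_subset_of_card_le (fun m hm => hsub m hm y' hy') ?_
      rw [← Nat.cast_le (α := ℝ), h𝒞.card_lineSet hG hb hD (mem_filter.1 hy).2,
        h𝒞.card_lineSet hG hb hD (mem_filter.1 hy').2]
    rw [← heq y₁ (mem_filter.2 ⟨hy₁, hxy₁⟩), ← heq y₂ (mem_filter.2 ⟨hy₂, hxy₂⟩)]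
  · exfalso
    push Not at hgood
    set B : Finset (Finset V) := {m ∈ linesThrough 𝒞 x | ∃ y ∈ Y, m ∉ S y}
    have hcover : Y ⊆ B.biUnion fun m => {y ∈ l | G.dist x y = 2 ∧ m ∈ lineSet G 𝒞 x y} := by
      intro y hy
      obtain ⟨m, hm, hm'⟩ := hgood y hy
      have hm2 := mem_filter.1 hm
      have hy2 := mem_filter.1 hy
      exact mem_biUnion.2 ⟨m, mem_filter.2 ⟨hm2.1, hm'⟩, mem_filter.2 ⟨hy2.1, hy2.2, hm2.2⟩⟩
    have hYle : (#Y : ℝ) ≤ #B * (α * b) := by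
      calc (#Y : ℝ) ≤ ∑ m ∈ B, (#{y ∈ l | G.dist x y = 2 ∧ m ∈ lineSet G 𝒞 x y} : ℝ) := by
            exact_mod_cast (card_le_card hcover).trans card_biUnion_le
        _ ≤ ∑ m ∈ B, α * b := sum_le_sum fun m hm => by
            obtain ⟨hm, y, hy, hmy⟩ := mem_filter.1 hm
            have hy2 := mem_filter.1 hy
            exact h𝒞.card_filter_mem_lineSet_le hG hb hD hl hz₀ hxz₀ hmin hy2.1 hy2.2 hm
              fun hmem => hmy (mem_filter.2 ⟨hm, hmem⟩)
        _ = #B * (α * b) := by rw [sum_const, nsmul_eq_mul]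
    -- A line joining `x` to a neighbour `z` on `l` is in `[x, y]` for every `y ∈ Y`, because `z` is
    -- adjacent to `y`; so it is not in `B`.
    have hB : (#B : ℝ) + (1 + α) ≤ gaussNum b D := by
      rw [← hN, ← h𝒞.card_linesThrough hG hb (by omega) x, ← Nat.cast_add, Nat.cast_le,
        ← card_filter_add_card_filter_not (s := linesThrough 𝒞 x) fun m => ∃ y ∈ Y, m ∉ S y]
      refine Nat.add_le_add_left (h𝒞.card_filter_dist_one_le hl hx ?_) _
      rintro m hm ⟨z, hz, hzm, hxz⟩
      rw [mem_filter]
      refine ⟨hm, ?_⟩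
      rintro ⟨y, hy, hmy⟩
      have hy2 := mem_filter.1 hy
      refine hmy (mem_filter.2 ⟨hm, (h𝒞.mem_lineSet_iff hG hb hD hy2.2).2 ⟨hm, z, hzm, ?_⟩⟩)
      refine SimpleGraph.dist_eq_one_iff_adj.2 ((h𝒞.1 l hl).1 hy2.1 hz ?_)
      rintro rfl
      omega
    have := mul_le_mul_of_nonneg_right hB (mul_nonneg hα hb.le)
    linarith

end IsGeometricWith

end Main

end ClassicalDRG

theorem theorem18 {V : Type*} [Fintype V] [DecidableEq V]
    (G : SimpleGraph V) [DecidableRel G.Adj] (D : ℕ) (b α β : ℝ)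
    (hG : ClassicalDRG.HasClassicalParameters G D b α β)
    (hb : 2 ≤ b) (hD : 3 ≤ D)
    (𝒞 : Set (Finset V)) (h𝒞 : ClassicalDRG.IsGeometricWith G 𝒞)
    (hβ : (ClassicalDRG.gaussNum b D - α - 1) * α * b + α < β)
    (x : V) (l : Finset V) (hl : l ∈ 𝒞) (hxl : ClassicalDRG.distToSet G x l = 1)
    (y₁ y₂ : V) (hy₁ : y₁ ∈ l) (hy₂ : y₂ ∈ l)
    (hxy₁ : G.dist x y₁ = 2) (hxy₂ : G.dist x y₂ = 2) :
    ClassicalDRG.lineSet G 𝒞 x y₁ = ClassicalDRG.lineSet G 𝒞 x y₂ := by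
  exact h𝒞.lineSet_eq_lineSet hG (by linarith) hD hβ hl hxl hy₁ hy₂ hxy₁ hxy₂
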